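/- Let $G$ be a Poisson Lie group, i.e. a (finite-dimensional, real, smooth) Lie group with a Poisson bivector field $\Lambda\in\Gamma(\wedge^2TG)$, $[\Lambda,\Lambda]=0$, such that $$\Lambda(gh)=(L_g)_*\Lambda(h)+(R_h)_*\Lambda(g)\qquad\text{for all } g,h\in G,$$ where $L_g$ and $R_h$ are left and right translation. Let $\mathfrak g=T_eG$ be its Lie algebra, and let $\mathfrak g^*$ carry the Lie bracket dual to the cobracket $\delta:\mathfrak g\to\wedge^2\mathfrak g$, the derivative at $e$ of the map $k\mapsto (R_{k^{-1}})_*\Lambda(k)$; that is, $\langle[\xi,\zeta],X\rangle=\delta(X)(\xi,\zeta)$. For $g\in G$ put $$\eta^g:=(L_g)_*\Lambda(g^{-1})\in\wedge^2\mathfrak g,\qquad \mathfrak h^g:=(\eta^g)^\sharp\,\mathfrak g^*\subset\mathfrak g,$$ where $(\eta^g)^\sharp:\mathfrak g^*\to\mathfrak g$ is contraction with $\eta^g$. Equivalently, $\mathfrak h^g$ is the left translation to the identity of the tangent space at $g^{-1}$ of the symplectic leaf of $(G,\Lambda)$ through $g^{-1}$. Let $g\in G$. If $\mathfrak h^g$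 is a Lie subalgebra of $\mathfrak g$, then it is automatically a coisotropic subalgebra, i.e. its annihilator $(\mathfrak h^g)^\circ=\{\xi\in\mathfrak g^*:\xi|_{\mathfrak h^g}=0\}$ is a Lie subalgebra of $\mathfrak g^*$. -/

import Mathlib

open Bundle
open scoped Manifold ContDiff

noncomputable section

namespace PoissonLie

section Manifolds

variable {E : Type*} [NormedAddCommGroup E] [NormedSpace ℝ E]
  {H : Type*} [TopologicalSpace H] (I : ModelWithCorners ℝ E H)
  {M : Type*} [TopologicalSpace M] [ChartedSpace H M]
  {N : Type*} [TopologicalSpace N] [ChartedSpace H N]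

/-- The cotangent space `T*ₓM`. -/
abbrev Cotangent (x : M) : Type _ := TangentSpace I x →L[ℝ] ℝ

/-- The space of linear maps `T*ₓM → TₓM`. When `M` is finite-dimensional, contraction identifies
`Λ ∈ TₓM ⊗ TₓM` with the map `Λ^♯ : T*ₓM → TₓM` such that `⟨ζ, Λ^♯ ξ⟩ = Λ(ξ, ζ)`, and we encode `Λ`
by `Λ^♯`. The elements of `∧² TₓM` are those with `Λ(ξ, ξ) = ⟨ξ, Λ^♯ ξ⟩ = 0` for all `ξ`. -/
abbrev TwoTensor (x : M) : Type _ := Cotangent I x →L[ℝ] TangentSpace I x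

/-- The differential at `x` of a map `f : M → N` with `f x = y`, as a linear map `TₓM → T_yN`. -/
def tangentMap (f : M → N) {x : M} {y : N} (h : f x = y) :
    TangentSpace I x →L[ℝ] TangentSpace I y :=
  h ▸ mfderiv I I f x

/-- The pushforward `f_* Λ ∈ T_yN ⊗ T_yN` of `Λ ∈ TₓM ⊗ TₓM` by a map `f` with `f x = y`, that is
`(f_* Λ)(ξ, ζ) = Λ(f^* ξ, f^* ζ)`. In terms of contractions, `(f_* Λ)^♯ = f_* ∘ Λ^♯ ∘ f^*`. -/
def pushforward (f : M → N) {x : M} {y : N} (h : f x = y) (Λ : TwoTensor I x) :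
    Cotangent I y →ₗ[ℝ] TangentSpace I y where
  toFun ξ := tangentMap I f h (Λ (ξ.comp (tangentMap I f h)))
  map_add' ξ ζ := by
    rw [ContinuousLinearMap.add_comp, map_add, map_add]
  map_smul' c ξ := by
    rw [ContinuousLinearMap.smul_comp, map_smul, map_smul, RingHom.id_apply]

/-- The bracket `{f₁, f₂} = Λ(df₁, df₂)` of functions on `M` defined by a field `Λ`. -/
def poissonBracket (Λ : ∀ x : M, TwoTensor I x) (f₁ f₂ : M → ℝ) (x : M) : ℝ :=
  mvfderiv I f₂ x (Λ x (mvfderiv I f₁ x))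

/-- `Λ` is a smooth bivector field: an alternating smooth section of the vector bundle
`Hom(T*M, TM) = TM ⊗ TM`. -/
structure IsBivectorField [IsManifold I 1 M] (Λ : ∀ x : M, TwoTensor I x) : Prop where
  smooth : ContMDiff I (I.prod 𝓘(ℝ, (E →L[ℝ] ℝ) →L[ℝ] E)) ∞
    (fun x : M => (TotalSpace.mk' ((E →L[ℝ] ℝ) →L[ℝ] E) x (Λ x) :
      TotalSpace ((E →L[ℝ] ℝ) →L[ℝ] E) (fun x : M =>
        (TangentSpace I x →L[ℝ] Bundle.Trivial M ℝ x) →L[ℝ] TangentSpace I x)))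
  alternating : ∀ (x : M) (ξ : Cotangent I x), ξ (Λ x ξ) = 0

/-- `Λ` is a Poisson bivector field: a smooth bivector field whose bracket of smooth functions
satisfies the Jacobi identity. The cyclic sum below is, up to a nonzero constant factor, the value
`[Λ, Λ](df₁, df₂, df₃)` of the Schouten bracket of `Λ` with itself, so this is the condition
`[Λ, Λ] = 0`. -/
structure IsPoisson [IsManifold I 1 M] (Λ : ∀ x : M, TwoTensor I x) : Prop
    extends IsBivectorField I Λ where
  jacobi : ∀ f₁ f₂ f₃ : M → ℝ, ContMDiff I 𝓘(ℝ) ∞ f₁ → ContMDiff I 𝓘(ℝ) ∞ f₂ →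
    ContMDiff I 𝓘(ℝ) ∞ f₃ → ∀ x : M,
      poissonBracket I Λ (poissonBracket I Λ f₁ f₂) f₃ x +
      poissonBracket I Λ (poissonBracket I Λ f₂ f₃) f₁ x +
      poissonBracket I Λ (poissonBracket I Λ f₃ f₁) f₂ x = 0

end Manifolds

section Groups

variable {E : Type*} [NormedAddCommGroup E] [NormedSpace ℝ E]
  {H : Type*} [TopologicalSpace H] (I : ModelWithCorners ℝ E H)
  {G : Type*} [TopologicalSpace G] [ChartedSpace H G] [Group G]

/-- `Λ` makes `G` a Poisson Lie group: it is a Poisson bivector field with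
`Λ(gh) = (L_g)_* Λ(h) + (R_h)_* Λ(g)` for all `g, h ∈ G`. -/
structure IsPoissonLie [IsManifold I 1 G] (Λ : ∀ x : G, TwoTensor I x) : Prop
    extends IsPoisson I Λ where
  multiplicative : ∀ (g h : G) (ξ : Cotangent I (g * h)),
    Λ (g * h) ξ =
      pushforward I (fun x : G => g * x) (x := h) rfl (Λ h) ξ +
      pushforward I (fun x : G => x * h) (x := g) rfl (Λ g) ξ

variable (G) in
/-- The dual `𝔤*` of the Lie algebra `𝔤 = T₁G`. -/
abbrev LieDual : Type _ := GroupLieAlgebra I G →L[ℝ] ℝ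

/-- The bracket on `𝔤*` given by a Poisson Lie structure `Λ`. It is dual to the cobracket
`δ : 𝔤 → ∧² 𝔤`, the derivative at the identity of the map
`G → ∧² 𝔤, k ↦ (R_{k⁻¹})_* Λ(k)`: that is, `⟨[ξ, ζ], X⟩ = δ(X)(ξ, ζ)` for `X ∈ 𝔤`. -/
def dualBracket (Λ : ∀ x : G, TwoTensor I x) (ξ ζ : LieDual I G) : LieDual I G :=
  mvfderiv I (fun k : G =>
    ζ (pushforward I (fun x : G => x * k⁻¹) (x := k) (y := 1) (mul_inv_cancel k) (Λ k) ξ)) 1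

/-- The contraction `(η^g)^♯ : 𝔤* → 𝔤` with `η^g = (L_g)_* Λ(g⁻¹) ∈ ∧² 𝔤`. -/
def eta (Λ : ∀ x : G, TwoTensor I x) (g : G) : LieDual I G →ₗ[ℝ] GroupLieAlgebra I G :=
  pushforward I (fun x : G => g * x) (x := g⁻¹) (y := 1) (mul_inv_cancel g) (Λ g⁻¹)

/-- The subspace `𝔥^g = (η^g)^♯ 𝔤*` of `𝔤`. As `L_g` is a diffeomorphism, it is the image under
`(L_g)_*` of `Λ(g⁻¹)^♯ (T*G)`, the tangent space at `g⁻¹` of the symplectic leaf through `g⁻¹`. -/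
def leafSubspace (Λ : ∀ x : G, TwoTensor I x) (g : G) : Submodule ℝ (GroupLieAlgebra I G) :=
  LinearMap.range (eta I Λ g)

/-- The annihilator `V° ⊂ 𝔤*` of a subspace `V ⊂ 𝔤`. -/
def annihilator (V : Submodule ℝ (GroupLieAlgebra I G)) : Submodule ℝ (LieDual I G) where
  carrier := {ξ | ∀ v ∈ V, ξ v = 0}
  add_mem' := by
    intro ξ ζ hξ hζ v hv
    rw [add_apply, hξ v hv, hζ v hv, add_zero]
  zero_mem' := fun _ _ => rfl
  smul_mem' := by
    intro c ξ hξ v hv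
    rw [smul_apply, hξ v hv, smul_zero]

/-- A smooth Lie group has the finite smoothness that the Lie algebra structure of
`GroupLieAlgebra I G` asks for. -/
instance lieGroup_minSmoothness [LieGroup I ∞ G] : LieGroup I (minSmoothness ℝ 3) G :=
  LieGroup.of_le (n := ∞) (by
    rw [minSmoothness_of_isRCLikeNormedField]; exact ENat.LEInfty.out)

/-- A Lie subalgebra `𝔥` of `𝔤` is coisotropic if its annihilator is a Lie subalgebra of `𝔤*`,
i.e. a subspace closed under the bracket. -/
def IsCoisotropic [CompleteSpace E] [LieGroup I ∞ G] (Λ : ∀ x : G, TwoTensor I x)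
    (h : LieSubalgebra ℝ (GroupLieAlgebra I G)) : Prop :=
  ∀ ξ ∈ annihilator I h.toSubmodule, ∀ ζ ∈ annihilator I h.toSubmodule,
    dualBracket I Λ ξ ζ ∈ annihilator I h.toSubmodule

end Groups

end PoissonLie

end

/-!
The argument is that the kernel of a Poisson tensor at a point carries an isotropy Lie bracket, and
that multiplicativity identifies this bracket at `x = g⁻¹` with the bracket of `𝔤*`.

Write covectors `ξ, ζ` in the annihilator of `𝔥^g` as `dφ₁, dφ₂` at the identity, and put
`fᵢ = φᵢ ∘ L_g`. As `Λ` is antisymmetric, `ξ` annihilates `𝔥^g` exactly when `df₁` lies in the kernel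
of `Λ^♯` at `x`, and likewise for `ζ`. The Jacobi identity for `f₁, f₂, f₃` at `x` then reduces to its
first term, so `d{f₁, f₂}` annihilates the image of `Λ^♯` at `x`
(`PoissonLie.IsPoisson.mvfderiv_poissonBracket_apply`). On the other hand multiplicativity gives
`{f₁, f₂}(x k) = {φ₁, φ₂}(k) + {f₁ ∘ R_k, f₂ ∘ R_k}(x)`. The derivative of the first term at `k = 1` is
`[ξ, ζ]` (`PoissonLie.IsPoissonLie.mvfderiv_poissonBracket_one`), and that of the second term is zero,
because both covectors lie in the kernel at `k = 1`
(`PoissonLie.IsPoissonLie.mvfderiv_poissonBracket_mul_right`). Hence `d{f₁, f₂}` at `x` is the pullback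
of `[ξ, ζ]` by `L_g`, and `[ξ, ζ]` annihilates `(L_g)_* Λ^♯(T*ₓG) = 𝔥^g`.

Both derivative computations rest on `PoissonLie.mvfderiv_pairing_eq_zero`: the pairing of a covector
field and a vector field that vanish at the same point has zero derivative there.
-/

namespace PoissonLie

/-! ### Covector fields and Poisson brackets on manifolds -/

section Manifolds

open Filter Topology

variable {E : Type*} [NormedAddCommGroup E] [NormedSpace ℝ E]
  {H : Type*} [TopologicalSpace H] {I : ModelWithCorners ℝ E H}
  {M : Type*} [TopologicalSpace M] [ChartedSpace H M]
  {E' : Type*} [NormedAddCommGroup E'] [NormedSpace ℝ E']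
  {H' : Type*} [TopologicalSpace H'] {J : ModelWithCorners ℝ E' H'}
  {N : Type*} [TopologicalSpace N] [ChartedSpace H' N]

/-- The pullback of `dφ` by `f` is `d(φ ∘ f)`. -/
lemma mvfderiv_comp_tangentMap {φ : M → ℝ} {f : M → M} {x y : M} (h : f x = y)
    (hφ : MDifferentiableAt I 𝓘(ℝ) φ y) (hf : MDifferentiableAt I I f x) :
    (mvfderiv I φ y).comp (tangentMap I f h) = mvfderiv I (fun z => φ (f z)) x := by
  subst h
  exact (mvfderiv_comp x hφ hf).symm

lemma mvfderiv_sub_of_contMDiff {f g : M → ℝ} (hf : ContMDiff I 𝓘(ℝ) ∞ f)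
    (hg : ContMDiff I 𝓘(ℝ) ∞ g) (x : M) :
    mvfderiv I (fun y => f y - g y) x = mvfderiv I f x - mvfderiv I g x :=
  mvfderiv_fun_sub (hf.mdifferentiable (by simp) x) (hg.mdifferentiable (by simp) x)

/-- For a family of functions `F s` on `M` and a map `b : N → M`, the covectors `d(F s)` at `b s`
form a differentiable section of the cotangent bundle along `b`. Both the case `b = id` and the case
of a constant `b` are needed. -/
lemma mdifferentiableAt_mvfderiv_section [IsManifold I 1 M] [IsManifold J 1 N]
    {F : N → M → ℝ} {b : N → M} {t : N}
    (hF : ContMDiffAt (J.prod I) 𝓘(ℝ) 2 (Function.uncurry F) (t, b t))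
    (hb : ContMDiffAt J I 1 b t) :
    MDifferentiableAt J (I.prod 𝓘(ℝ, E →L[ℝ] ℝ))
      (fun s => (TotalSpace.mk' (E →L[ℝ] ℝ) (b s) (mvfderiv I (F s) (b s)) :
        TotalSpace (E →L[ℝ] ℝ) (fun x : M => TangentSpace I x →L[ℝ] Bundle.Trivial M ℝ x))) t := by
  refine (mdifferentiableAt_hom_bundle _).2 ⟨hb.mdifferentiableAt one_ne_zero, ?_⟩
  have h := (ContMDiffAt.mfderiv (m := 1) F b hF hb (by norm_num)).mdifferentiableAt one_ne_zero
  refine h.congr_of_eventuallyEq (Eventually.of_forall fun s => ?_)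
  ext v
  simp [inTangentCoordinates, ContinuousLinearMap.inCoordinates, mvfderiv]
  rfl

/-- A pairing of two factors that both vanish at `t` vanishes to second order at `t`. -/
lemma hasMFDerivAt_clm_apply_zero {F : Type*} [NormedAddCommGroup F] [NormedSpace ℝ F]
    {c : N → F →L[ℝ] ℝ} {Z : N → F} {t : N} (hc : MDifferentiableAt J 𝓘(ℝ, F →L[ℝ] ℝ) c t)
    (hZ : MDifferentiableAt J 𝓘(ℝ, F) Z t) (hc0 : c t = 0) (hZ0 : Z t = 0) :
    HasMFDerivAt J 𝓘(ℝ) (fun s => c s (Z s)) t (0 : E' →L[ℝ] ℝ) := by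
  refine ⟨hc.continuousAt.clm_apply hZ.continuousAt, ?_⟩
  obtain ⟨c', hc'⟩ : ∃ c' : E' →L[ℝ] F →L[ℝ] ℝ, HasFDerivWithinAt (c ∘ (extChartAt J t).symm) c'
      (Set.range J) (extChartAt J t t) := ⟨_, hc.hasMFDerivAt.2⟩
  obtain ⟨Z', hZ'⟩ : ∃ Z' : E' →L[ℝ] F, HasFDerivWithinAt (Z ∘ (extChartAt J t).symm) Z'
      (Set.range J) (extChartAt J t t) := ⟨_, hZ.hasMFDerivAt.2⟩
  have h := hc'.clm_apply hZ'
  simp only [Function.comp_apply, extChartAt_to_inv, hc0, hZ0, ContinuousLinearMap.zero_comp,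
    map_zero, add_zero] at h
  exact h

/-- A covector field and a vector field along `b` that both vanish at `t` have a pairing whose
derivative at `t` is zero. Reading both in the trivialization at `b t` reduces this to fixed vector
spaces. -/
lemma mvfderiv_pairing_eq_zero [IsManifold I 1 M] {b : N → M}
    {c : ∀ s, TangentSpace I (b s) →L[ℝ] ℝ} {Z : ∀ s, TangentSpace I (b s)} {t : N}
    (hc : MDifferentiableAt J (I.prod 𝓘(ℝ, E →L[ℝ] ℝ))
      (fun s => (TotalSpace.mk' (E →L[ℝ] ℝ) (b s) (c s) :
        TotalSpace (E →L[ℝ] ℝ) (fun x : M => TangentSpace I x →L[ℝ] Bundle.Trivial M ℝ x))) t)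
    (hZ : MDifferentiableAt J I.tangent (fun s => (TotalSpace.mk' E (b s) (Z s) :
      TangentBundle I M)) t) (hc0 : c t = 0) (hZ0 : Z t = 0) :
    mvfderiv J (fun s => c s (Z s)) t = 0 := by
  obtain ⟨hb, hc'⟩ := (mdifferentiableAt_hom_bundle _).1 hc
  have hZ' := ((mdifferentiableAt_totalSpace ..).1 hZ).2
  dsimp only at hb hc' hZ'
  have key : (fun s => c s (Z s)) =ᶠ[𝓝 t] fun s =>
      (ContinuousLinearMap.inCoordinates E (TangentSpace I) ℝ (Bundle.Trivial M ℝ)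
        (b t) (b s) (b t) (b s) (c s)) ((trivializationAt E (TangentSpace I) (b t)
          ⟨b s, Z s⟩).2) := by
    have A : ∀ᶠ s in 𝓝 t, b s ∈ (trivializationAt E (TangentSpace I) (b t)).baseSet :=
      hb.continuousAt ((trivializationAt E (TangentSpace I) (b t)).open_baseSet.mem_nhds
        (FiberBundle.mem_baseSet_trivializationAt' (b t)))
    filter_upwards [A] with s hs
    rw [ContinuousLinearMap.inCoordinates_eq hs (by simp)]
    simp
    rw [Trivialization.symm_apply_apply_mk _ hs]
  have hZt : ((trivializationAt E (TangentSpace I) (b t) ⟨b t, Z t⟩).2) = 0 := by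
    rw [hZ0]
    exact congrArg Prod.snd (Trivialization.zeroSection ℝ _
      (FiberBundle.mem_baseSet_trivializationAt' (b t)))
  have hct : ContinuousLinearMap.inCoordinates E (TangentSpace I) ℝ (Bundle.Trivial M ℝ)
        (b t) (b t) (b t) (b t) (c t) = 0 := by
    rw [hc0]
    simp [ContinuousLinearMap.inCoordinates]
  exact ((hasMFDerivAt_clm_apply_zero hc' hZ' hct hZt).congr_of_eventuallyEq key).mfderiv

lemma mdifferentiableAt_pairing [IsManifold I 1 M] {b : N → M}
    {c : ∀ s, TangentSpace I (b s) →L[ℝ] ℝ} {Z : ∀ s, TangentSpace I (b s)} {t : N}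
    (hc : MDifferentiableAt J (I.prod 𝓘(ℝ, E →L[ℝ] ℝ))
      (fun s => (TotalSpace.mk' (E →L[ℝ] ℝ) (b s) (c s) :
        TotalSpace (E →L[ℝ] ℝ) (fun x : M => TangentSpace I x →L[ℝ] Bundle.Trivial M ℝ x))) t)
    (hZ : MDifferentiableAt J I.tangent (fun s => (TotalSpace.mk' E (b s) (Z s) :
      TangentBundle I M)) t) :
    MDifferentiableAt J 𝓘(ℝ) (fun s => c s (Z s)) t := by
  have h := MDifferentiableAt.clm_bundle_apply (E₁ := TangentSpace I)
    (E₂ := Bundle.Trivial M ℝ) hc hZ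
  have := ((mdifferentiableAt_totalSpace ..).1 h).2
  simpa using this

/-- Every covector is the differential of a globally defined smooth function: cut off a linear
function of the chart coordinates by a bump function. -/
lemma exists_contMDiff_mvfderiv_eq [FiniteDimensional ℝ E] [I.Boundaryless] [T2Space M]
    [IsManifold I ∞ M] (x : M) (α : TangentSpace I x →L[ℝ] ℝ) :
    ∃ φ : M → ℝ, ContMDiff I 𝓘(ℝ) ∞ φ ∧ mvfderiv I φ x = α := by
  let β : SmoothBumpFunction I x := Classical.arbitrary _
  let α' : E →L[ℝ] ℝ := α
  refine ⟨fun y => β y • α' (extChartAt I x y), β.contMDiff_smul ?_, ?_⟩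
  · exact α'.contMDiff.comp_contMDiffOn contMDiffOn_extChartAt
  · have h1 : HasMFDerivAt I 𝓘(ℝ) (fun y => α' (extChartAt I x y)) x α' := by
      have h := hasMFDerivAt_extChartAt (I := I) (mem_chart_source H x)
      rw [mfderiv_chartAt_eq_tangentCoordChange (mem_chart_source H x)] at h
      have h' : tangentCoordChange I x x x = ContinuousLinearMap.id ℝ E := by
        ext v
        exact tangentCoordChange_self (mem_extChartAt_source x)
      rw [h'] at h
      exact α'.hasMFDerivAt.comp x h
    have h2 : HasMFDerivAt I 𝓘(ℝ) (fun y => β y • α' (extChartAt I x y)) x α' := by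
      refine h1.congr_of_eventuallyEq ?_
      filter_upwards [β.eventuallyEq_one] with y hy
      simp [hy]
    exact h2.mfderiv

lemma IsBivectorField.mdifferentiableAt_apply [IsManifold I 1 M] {Λ : ∀ x : M, TwoTensor I x}
    (hΛ : IsBivectorField I Λ) {b : N → M} {a : ∀ s, Cotangent I (b s)} {t : N}
    (ha : MDifferentiableAt J (I.prod 𝓘(ℝ, E →L[ℝ] ℝ))
      (fun s => (TotalSpace.mk' (E →L[ℝ] ℝ) (b s) (a s) :
        TotalSpace (E →L[ℝ] ℝ) (fun x : M => TangentSpace I x →L[ℝ] Bundle.Trivial M ℝ x))) t) :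
    MDifferentiableAt J I.tangent
      (fun s => (TotalSpace.mk' E (b s) (Λ (b s) (a s)) : TangentBundle I M)) t := by
  have hb := ((mdifferentiableAt_hom_bundle _).1 ha).1
  have h := (hΛ.smooth.mdifferentiable (by simp) (b t)).comp t hb
  exact MDifferentiableAt.clm_bundle_apply (F₁ := E →L[ℝ] ℝ) (F₂ := E) (b := b)
    (E₁ := fun x : M => TangentSpace I x →L[ℝ] Bundle.Trivial M ℝ x)
    (E₂ := fun x : M => TangentSpace I x) h ha

lemma IsBivectorField.antisymm [IsManifold I 1 M] {Λ : ∀ x : M, TwoTensor I x}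
    (hΛ : IsBivectorField I Λ) (x : M) (ξ ζ : Cotangent I x) : ζ (Λ x ξ) = -ξ (Λ x ζ) := by
  have h := hΛ.alternating x (ξ + ζ)
  simp only [map_add, add_apply, hΛ.alternating] at h
  linarith

/-- If `df₁` and `df₂` lie in the kernel of `Λ^♯` at `x`, then `d{f₁, f₂}` annihilates the image
of `Λ^♯` at `x`: in the Jacobi identity the other two terms vanish. -/
lemma IsPoisson.mvfderiv_poissonBracket_apply [IsManifold I 1 M] {Λ : ∀ x : M, TwoTensor I x}
    (hΛ : IsPoisson I Λ) {f₁ f₂ f₃ : M → ℝ}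
    (hf₁ : ContMDiff I 𝓘(ℝ) ∞ f₁) (hf₂ : ContMDiff I 𝓘(ℝ) ∞ f₂)
    (hf₃ : ContMDiff I 𝓘(ℝ) ∞ f₃) {x : M}
    (h₁ : Λ x (mvfderiv I f₁ x) = 0) (h₂ : Λ x (mvfderiv I f₂ x) = 0) :
    mvfderiv I (poissonBracket I Λ f₁ f₂) x (Λ x (mvfderiv I f₃ x)) = 0 := by
  have h := hΛ.jacobi f₁ f₂ f₃ hf₁ hf₂ hf₃ x
  have e (F f : M → ℝ) : poissonBracket I Λ F f x = -mvfderiv I F x (Λ x (mvfderiv I f x)) :=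
    hΛ.antisymm x _ _
  rw [e, e, e, h₁, h₂, map_zero, map_zero] at h
  linarith

end Manifolds

/-! ### Poisson Lie groups -/

section Groups

variable {E : Type*} [NormedAddCommGroup E] [NormedSpace ℝ E]
  {H : Type*} [TopologicalSpace H] {I : ModelWithCorners ℝ E H}
  {G : Type*} [TopologicalSpace G] [ChartedSpace H G] [Group G] [LieGroup I ∞ G]
  {Λ : ∀ x : G, TwoTensor I x}

/-- Multiplicativity of `Λ`, read on functions. -/
lemma IsPoissonLie.poissonBracket_mul (hΛ : IsPoissonLie I Λ) {f₁ f₂ : G → ℝ}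
    (hf₁ : ContMDiff I 𝓘(ℝ) ∞ f₁) (hf₂ : ContMDiff I 𝓘(ℝ) ∞ f₂) (x k : G) :
    poissonBracket I Λ f₁ f₂ (x * k) =
      poissonBracket I Λ (fun y => f₁ (x * y)) (fun y => f₂ (x * y)) k +
      poissonBracket I Λ (fun y => f₁ (y * k)) (fun y => f₂ (y * k)) x := by
  have h₁ := hf₁.mdifferentiable (by simp) (x * k)
  have h₂ := hf₂.mdifferentiable (by simp) (x * k)
  have hL : MDifferentiableAt I I (fun y => x * y) k :=
    (contMDiff_mul_left (I := I) (n := ∞)).mdifferentiable (by simp) k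
  have hR : MDifferentiableAt I I (fun y => y * k) x :=
    (contMDiff_mul_right (I := I) (n := ∞)).mdifferentiable (by simp) x
  have hL₁ := mvfderiv_comp_tangentMap (x := k) (y := x * k) rfl h₁ hL
  have hL₂ := mvfderiv_comp_tangentMap (x := k) (y := x * k) rfl h₂ hL
  have hR₁ := mvfderiv_comp_tangentMap (x := x) (y := x * k) rfl h₁ hR
  have hR₂ := mvfderiv_comp_tangentMap (x := x) (y := x * k) rfl h₂ hR
  rw [poissonBracket, hΛ.multiplicative, map_add, poissonBracket, poissonBracket,
    ← hL₁, ← hL₂, ← hR₁, ← hR₂]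
  rfl

/-- The bracket of `dφ₁` and `dφ₂` in `𝔤*` as the derivative of the Poisson brackets of the
right-translated functions `φᵢ ∘ R_{k⁻¹}` at `k`. -/
lemma dualBracket_mvfderiv {φ₁ φ₂ : G → ℝ}
    (hφ₁ : ContMDiff I 𝓘(ℝ) ∞ φ₁) (hφ₂ : ContMDiff I 𝓘(ℝ) ∞ φ₂) :
    dualBracket I Λ (mvfderiv I φ₁ 1) (mvfderiv I φ₂ 1) =
      mvfderiv I (fun k : G => poissonBracket I Λ (fun y => φ₁ (y * k⁻¹)) (fun y => φ₂ (y * k⁻¹)) k)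
        1 := by
  rw [dualBracket]
  congr 1
  ext k
  have hR : MDifferentiableAt I I (fun y => y * k⁻¹) k :=
    (contMDiff_mul_right (I := I) (n := ∞)).mdifferentiable (by simp) k
  rw [poissonBracket, ← mvfderiv_comp_tangentMap (f := fun y => y * k⁻¹) (mul_inv_cancel k)
    (hφ₁.mdifferentiable (by simp) 1) hR,
    ← mvfderiv_comp_tangentMap (f := fun y => y * k⁻¹) (mul_inv_cancel k)
    (hφ₂.mdifferentiable (by simp) 1) hR]
  rfl

/-- Mathlib's `LieGroup` does not assume the Hausdorff property, which bump functions need; it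
follows from the charts being T₁ and the group being topological. -/
lemma t2Space_of_lieGroup {E : Type*} [NormedAddCommGroup E] [NormedSpace ℝ E]
    {H : Type*} [TopologicalSpace H] (I : ModelWithCorners ℝ E H)
    (G : Type*) [TopologicalSpace G] [ChartedSpace H G] [Group G] [LieGroup I ∞ G] :
    T2Space G := by
  have : T1Space G := I.t1Space G
  have : IsTopologicalGroup G := topologicalGroup_of_lieGroup I ∞
  infer_instance

/-- Multiplicativity at `(1, 1)` reads `Λ 1 = Λ 1 + Λ 1`. -/
lemma IsPoissonLie.apply_one [FiniteDimensional ℝ E] [I.Boundaryless] (hΛ : IsPoissonLie I Λ) :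
    Λ 1 = 0 := by
  have := t2Space_of_lieGroup I G
  ext ξ
  refine (SeparatingDual.eq_zero_of_forall_dual_eq_zero (R := ℝ) (V := E)) fun ζ => ?_
  obtain ⟨f₁, hf₁, rfl⟩ := exists_contMDiff_mvfderiv_eq (I := I) (1 : G) ξ
  obtain ⟨f₂, hf₂, rfl⟩ := exists_contMDiff_mvfderiv_eq (I := I) (1 : G) ζ
  have h := hΛ.poissonBracket_mul hf₁ hf₂ 1 1
  simp only [one_mul, mul_one] at h
  exact left_eq_add.1 h

lemma IsPoissonLie.mdifferentiableAt_poissonBracket (hΛ : IsPoissonLie I Λ) {φ₁ φ₂ : G → ℝ}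
    (hφ₁ : ContMDiff I 𝓘(ℝ) ∞ φ₁) (hφ₂ : ContMDiff I 𝓘(ℝ) ∞ φ₂) (x : G) :
    MDifferentiableAt I 𝓘(ℝ) (poissonBracket I Λ φ₁ φ₂) x := by
  have key {φ : G → ℝ} (hφ : ContMDiff I 𝓘(ℝ) ∞ φ) :=
    mdifferentiableAt_mvfderiv_section (I := I) (J := I) (F := fun _ : G => φ) (b := id) (t := x)
      ((hφ.of_le ENat.LEInfty.out).comp contMDiff_snd).contMDiffAt contMDiffAt_id
  exact mdifferentiableAt_pairing (key hφ₂) (hΛ.mdifferentiableAt_apply (key hφ₁))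

/-- The bracket of `𝔤*` linearizes the Poisson bracket of functions at the identity. Replacing
`φᵢ` by `φᵢ ∘ R_{k⁻¹}` changes the bracket at `k` by pairings in which both factors vanish at
`k = 1`, as `Λ 1 = 0`. -/
lemma IsPoissonLie.mvfderiv_poissonBracket_one [FiniteDimensional ℝ E] [I.Boundaryless]
    (hΛ : IsPoissonLie I Λ) {φ₁ φ₂ : G → ℝ}
    (hφ₁ : ContMDiff I 𝓘(ℝ) ∞ φ₁) (hφ₂ : ContMDiff I 𝓘(ℝ) ∞ φ₂) :
    mvfderiv I (poissonBracket I Λ φ₁ φ₂) 1 =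
      dualBracket I Λ (mvfderiv I φ₁ 1) (mvfderiv I φ₂ 1) := by
  have sR {φ : G → ℝ} (hφ : ContMDiff I 𝓘(ℝ) ∞ φ) (k : G) :
      ContMDiff I 𝓘(ℝ) ∞ (fun y => φ (y * k⁻¹)) := hφ.comp contMDiff_mul_right
  have sF {φ : G → ℝ} (hφ : ContMDiff I 𝓘(ℝ) ∞ φ) : ContMDiff (I.prod I) 𝓘(ℝ) 2
      (Function.uncurry fun k y : G => φ (y * k⁻¹)) :=
    (hφ.comp (contMDiff_snd.mul (contMDiff_fst.inv (I := I)))).of_le ENat.LEInfty.out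
  have sG {φ : G → ℝ} (hφ : ContMDiff I 𝓘(ℝ) ∞ φ) : ContMDiff (I.prod I) 𝓘(ℝ) 2
      (Function.uncurry fun _ y : G => φ y) :=
    (hφ.comp contMDiff_snd).of_le ENat.LEInfty.out
  have hsub {φ : G → ℝ} (hφ : ContMDiff I 𝓘(ℝ) ∞ φ) :=
    mdifferentiableAt_mvfderiv_section (I := I) (J := I)
      (F := fun k y : G => φ (y * k⁻¹) - φ y) (b := id) (t := 1)
      ((sF hφ).sub (sG hφ)).contMDiffAt contMDiffAt_id
  have hR := hΛ.mdifferentiableAt_apply (mdifferentiableAt_mvfderiv_section (I := I) (J := I)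
      (F := fun k y : G => φ₁ (y * k⁻¹)) (b := id) (t := 1) (sF hφ₁).contMDiffAt contMDiffAt_id)
  have hL := hΛ.mdifferentiableAt_apply (mdifferentiableAt_mvfderiv_section (I := I) (J := I)
      (F := fun _ : G => φ₂) (b := id) (t := 1) (sG hφ₂).contMDiffAt contMDiffAt_id)
  have hsub0 (φ : G → ℝ) : mvfderiv I (fun y : G => φ (y * (1 : G)⁻¹) - φ y) 1 = 0 := by
    simpa using! mvfderiv_const (I := I) (0 : ℝ) (x := (1 : G))
  have hΛ0 (ξ : Cotangent I (1 : G)) : Λ 1 ξ = 0 := by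
    rw [hΛ.apply_one]
    rfl
  have e₁ := mvfderiv_pairing_eq_zero (hsub hφ₂) hR (hsub0 φ₂) (hΛ0 _)
  have e₂ := mvfderiv_pairing_eq_zero (hsub hφ₁) hL (hsub0 φ₁) (hΛ0 _)
  have d₁ := mdifferentiableAt_pairing (hsub hφ₂) hR
  have d₂ := mdifferentiableAt_pairing (hsub hφ₁) hL
  have d := hΛ.mdifferentiableAt_poissonBracket hφ₁ hφ₂ 1
  have hsplit : (fun k : G => poissonBracket I Λ (fun y => φ₁ (y * k⁻¹)) (fun y => φ₂ (y * k⁻¹)) k) =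
      fun k => poissonBracket I Λ φ₁ φ₂ k +
        mvfderiv I (fun y : G => φ₂ (y * k⁻¹) - φ₂ y) k
          (Λ k (mvfderiv I (fun y : G => φ₁ (y * k⁻¹)) k)) -
        mvfderiv I (fun y : G => φ₁ (y * k⁻¹) - φ₁ y) k (Λ k (mvfderiv I φ₂ k)) := by
    ext k
    rw [mvfderiv_sub_of_contMDiff (sR hφ₂ k) hφ₂ k,
      mvfderiv_sub_of_contMDiff (sR hφ₁ k) hφ₁ k, poissonBracket, poissonBracket]
    have h₁ := hΛ.antisymm k (mvfderiv I φ₁ k) (mvfderiv I φ₂ k)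
    have h₂ := hΛ.antisymm k (mvfderiv I (fun y : G => φ₁ (y * k⁻¹)) k) (mvfderiv I φ₂ k)
    simp only [sub_apply]
    linarith
  rw [dualBracket_mvfderiv hφ₁ hφ₂, hsplit]
  refine Eq.symm ((mvfderiv_sub (d.add d₁) d₂).trans ?_)
  rw [mvfderiv_add d d₁, e₁, e₂, add_zero, sub_zero]

/-- If `df₁` and `df₂` lie in the kernel of `Λ^♯` at `x`, then the contribution of right
translations to the derivative of `k ↦ {f₁, f₂}(x k)` at the identity vanishes. -/
lemma IsPoissonLie.mvfderiv_poissonBracket_mul_right (hΛ : IsPoissonLie I Λ) {f₁ f₂ : G → ℝ}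
    (hf₁ : ContMDiff I 𝓘(ℝ) ∞ f₁) (hf₂ : ContMDiff I 𝓘(ℝ) ∞ f₂) {x : G}
    (h₁ : Λ x (mvfderiv I f₁ x) = 0) (h₂ : Λ x (mvfderiv I f₂ x) = 0) :
    MDifferentiableAt I 𝓘(ℝ)
      (fun k : G => poissonBracket I Λ (fun y => f₁ (y * k)) (fun y => f₂ (y * k)) x) 1 ∧
    mvfderiv I (fun k : G => poissonBracket I Λ (fun y => f₁ (y * k)) (fun y => f₂ (y * k)) x) 1
      = 0 := by
  have sR (k : G) : ContMDiff I 𝓘(ℝ) ∞ (fun y => f₂ (y * k)) := hf₂.comp contMDiff_mul_right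
  have sF {φ : G → ℝ} (hφ : ContMDiff I 𝓘(ℝ) ∞ φ) : ContMDiff (I.prod I) 𝓘(ℝ) 2
      (Function.uncurry fun k y : G => φ (y * k)) :=
    (hφ.comp (contMDiff_snd.mul contMDiff_fst)).of_le ENat.LEInfty.out
  have sG {φ : G → ℝ} (hφ : ContMDiff I 𝓘(ℝ) ∞ φ) : ContMDiff (I.prod I) 𝓘(ℝ) 2
      (Function.uncurry fun _ y : G => φ y) :=
    (hφ.comp contMDiff_snd).of_le ENat.LEInfty.out
  have hsub := mdifferentiableAt_mvfderiv_section (I := I) (J := I)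
      (F := fun k y : G => f₂ (y * k) - f₂ y) (b := fun _ => x) (t := 1)
      ((sF hf₂).sub (sG hf₂)).contMDiffAt contMDiffAt_const
  have hR := hΛ.mdifferentiableAt_apply (mdifferentiableAt_mvfderiv_section (I := I) (J := I)
      (F := fun k y : G => f₁ (y * k)) (b := fun _ => x) (t := 1) (sF hf₁).contMDiffAt
      contMDiffAt_const)
  have heq : (fun k : G => poissonBracket I Λ (fun y => f₁ (y * k)) (fun y => f₂ (y * k)) x) =
      fun k => mvfderiv I (fun y : G => f₂ (y * k) - f₂ y) x
          (Λ x (mvfderiv I (fun y : G => f₁ (y * k)) x)) := by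
    ext k
    -- By antisymmetry `df₂` also pairs to zero with the image of `Λ^♯`, so it can be
    -- subtracted to give a covector that vanishes at `k = 1`.
    have h := hΛ.antisymm x (mvfderiv I (fun y : G => f₁ (y * k)) x) (mvfderiv I f₂ x)
    rw [h₂, map_zero, neg_zero] at h
    rw [mvfderiv_sub_of_contMDiff (sR k) hf₂ x, poissonBracket, sub_apply, h,
      sub_zero]
  rw [heq]
  refine ⟨mdifferentiableAt_pairing hsub hR, mvfderiv_pairing_eq_zero hsub hR ?_ ?_⟩
  · simpa using! mvfderiv_const (I := I) (0 : ℝ) (x := x)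
  · simpa using h₁

end Groups

end PoissonLie

/-! ### The annihilator of the leaf subspace -/

theorem proposition2p3
    {E : Type*} [NormedAddCommGroup E] [NormedSpace ℝ E] [FiniteDimensional ℝ E] [CompleteSpace E]
    {H : Type*} [TopologicalSpace H] (I : ModelWithCorners ℝ E H) [I.Boundaryless]
    {G : Type*} [TopologicalSpace G] [ChartedSpace H G] [Group G] [LieGroup I ∞ G]
    (Λ : ∀ x : G, PoissonLie.TwoTensor I x) (hΛ : PoissonLie.IsPoissonLie I Λ) (g : G)
    (h : LieSubalgebra ℝ (GroupLieAlgebra I G))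
    (hh : h.toSubmodule = PoissonLie.leafSubspace I Λ g) :
    PoissonLie.IsCoisotropic I Λ h := by
  have := PoissonLie.t2Space_of_lieGroup I G
  rw [PoissonLie.IsCoisotropic, hh]
  intro ξ hξ ζ hζ
  have sL (x : G) : ContMDiff I I ∞ (fun y : G => x * y) := contMDiff_mul_left
  have dL := (sL g).mdifferentiable (by simp) g⁻¹
  have hcomp {φ : G → ℝ} (hφ : MDifferentiableAt I 𝓘(ℝ) φ 1) :=
    PoissonLie.mvfderiv_comp_tangentMap (f := fun y => g * y) (mul_inv_cancel g) hφ dL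
  -- Every covector at `g⁻¹` is pulled back by `L_g` from the identity, so a covector `dφ` at the
  -- identity annihilating `𝔥^g` has its pullback `d(φ ∘ L_g)` in the kernel of `Λ^♯` at `g⁻¹`.
  have hker {φ : G → ℝ} (hφ : ContMDiff I 𝓘(ℝ) ∞ φ)
      (hann : mvfderiv I φ 1 ∈ PoissonLie.annihilator I (PoissonLie.leafSubspace I Λ g)) :
      Λ g⁻¹ (mvfderiv I (fun y => φ (g * y)) g⁻¹) = 0 := by
    refine (SeparatingDual.eq_zero_of_forall_dual_eq_zero (R := ℝ) (V := E)) fun θ => ?_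
    obtain ⟨f, hf, rfl⟩ := PoissonLie.exists_contMDiff_mvfderiv_eq (I := I) (g⁻¹ : G) θ
    have hψ : ContMDiff I 𝓘(ℝ) ∞ (fun y => f (g⁻¹ * y)) := hf.comp (sL g⁻¹)
    have hθ := hcomp (hψ.mdifferentiable (by simp) 1)
    simp only [inv_mul_cancel_left] at hθ
    have hv := hann _ (LinearMap.mem_range_self _ (mvfderiv I (fun y => f (g⁻¹ * y)) 1))
    have hanti := hΛ.antisymm g⁻¹ (mvfderiv I (fun y => φ (g * y)) g⁻¹) (mvfderiv I f g⁻¹)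
    refine hanti.trans ?_
    rw [← hcomp (hφ.mdifferentiable (by simp) 1), ← hθ, neg_eq_zero]
    exact hv
  obtain ⟨φ₁, hφ₁, rfl⟩ := PoissonLie.exists_contMDiff_mvfderiv_eq (I := I) (1 : G) ξ
  obtain ⟨φ₂, hφ₂, rfl⟩ := PoissonLie.exists_contMDiff_mvfderiv_eq (I := I) (1 : G) ζ
  have hf₁ : ContMDiff I 𝓘(ℝ) ∞ (fun y => φ₁ (g * y)) := hφ₁.comp (sL g)
  have hf₂ : ContMDiff I 𝓘(ℝ) ∞ (fun y => φ₂ (g * y)) := hφ₂.comp (sL g)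
  obtain ⟨dB, hB⟩ := hΛ.mvfderiv_poissonBracket_mul_right hf₁ hf₂ (hker hφ₁ hξ) (hker hφ₂ hζ)
  have dA := hΛ.mdifferentiableAt_poissonBracket hφ₁ hφ₂ 1
  set b := PoissonLie.poissonBracket I Λ (fun y => φ₁ (g * y)) (fun y => φ₂ (g * y)) with hb
  have hF : (fun k => b (g⁻¹ * k)) = fun k => PoissonLie.poissonBracket I Λ φ₁ φ₂ k +
      PoissonLie.poissonBracket I Λ (fun y => φ₁ (g * (y * k))) (fun y => φ₂ (g * (y * k))) g⁻¹ := by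
    ext k
    simp only [hb, hΛ.poissonBracket_mul hf₁ hf₂, mul_inv_cancel_left]
  have hdF : mvfderiv I (fun k => b (g⁻¹ * k)) 1 =
      PoissonLie.dualBracket I Λ (mvfderiv I φ₁ 1) (mvfderiv I φ₂ 1) := by
    rw [hF, mvfderiv_fun_add dA dB, hB, add_zero, hΛ.mvfderiv_poissonBracket_one hφ₁ hφ₂]
  -- Pulling the last identity back by `L_g` shows that `d{f₁, f₂}` at `g⁻¹` is the pullback of
  -- `[dφ₁, dφ₂]`.
  have hdb := hcomp (φ := fun k => b (g⁻¹ * k)) (hF ▸ dA.add dB)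
  rw [hdF] at hdb
  simp only [inv_mul_cancel_left] at hdb
  rintro _ ⟨θ, rfl⟩
  obtain ⟨φ₃, hφ₃, rfl⟩ := PoissonLie.exists_contMDiff_mvfderiv_eq (I := I) (1 : G) θ
  have hJ := hΛ.mvfderiv_poissonBracket_apply hf₁ hf₂ (hφ₃.comp (sL g)) (hker hφ₁ hξ) (hker hφ₂ hζ)
  rw [← hb, ← hdb] at hJ
  have h₃ := hcomp (hφ₃.mdifferentiable (by simp) 1)
  erw [← h₃] at hJ
  exact hJ
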